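/- Let $l_1,\dots,l_D$ and $n_1,\dots,n_D$ be dimensions. For matrices $A_d\in\mathbb R^{m_d\times l_d}$ and $\mathcal C\in\mathbb R^{l_1\times\dots\times l_D}$ write $(A_1,\dots,A_D)\cdot\mathcal C=(A_1\otimes\dots\otimes A_D)\mathcal C$, and let $\mathcal C_{(d)}$ be the $d$th unfolding of $\mathcal C$, the matrix whose rows are indexed by the $d$th index of $\mathcal C$ and whose columns are indexed by the other indices. Tensor spaces carry the Frobenius inner product. Let $\mathcal M\subseteq\mathbb R^{l_1\times\dots\times l_D}$ be a Tucker core structure, that is, a smooth embedded submanifold such that every $\mathcal C\in\mathcal M$ satisfies $\operatorname{rank}\mathcal C_{(d)}=l_d$ for all $d$, and $(A_1,\dots,A_D)\cdot\mathcal C\in\mathcal M$ for all $\mathcal C\in\mathcal M$ and all $A_d\in\mathrm{GL}(l_d)$. Let $\mathcal M^{n_1,\dots,n_D}\subseteq\mathbb R^{n_1\times\dots\times n_D}$ be the $\mathcal M$-structured Tucker manifold, the set of all tensors $(V_1,\dots,V_D)\cdot\mathcal C$ with $\mathcal C\in\mathcal M$ and $V_d\in\mathbb R^{n_d\times l_d}$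 of rank $l_d$. Let $\mathcal X\in\mathcal M^{n_1,\dots,n_D}$ be given in compact HOSVD form $\mathcal X=(U_1,\dots,U_D)\cdot\mathcal C$; that is, for every $d$ the columns of $U_d\in\mathbb R^{n_d\times l_d}$ are an orthonormal basis of left singular vectors of $\mathcal X_{(d)}$ corresponding to its nonzero singular values. For each $d$ let $U_d^\perp\in\mathbb R^{n_d\times(n_d-l_d)}$ be such that the columns of $[\,U_d\ \ U_d^\perp\,]$ form an orthonormal basis of $\mathbb R^{n_d}$. Put $\sigma_j^d:=\|e_j^T\mathcal C_{(d)}\|$ and $\hat u_j^d:=(\sigma_j^d)^{-1}e_j\in\mathbb R^{l_d}$ for $j=1,\dots,l_d$. If $\mathcal B_{\mathcal C}$ is an orthonormal basis of the tangent space $T_{\mathcal C}\mathcal M$, then the tensors $$(U_1,\dots,U_D)\cdot\dot{\mathcal C},\qquad \dot{\mathcal C}\in\mathcal B_{\mathcal C},$$ together with the tensors $$(U_1,\dots,U_{d-1},\,U_d^\perp e_i(\hat u_j^d)^T,\,U_{d+1},\dots,U_D)\cdot\mathcal C,\qquad 1\le d\le D,\ 1\le i\le n_d-l_d,\ 1\le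 j\le l_d,$$ form an orthonormal basis of the tangent space $T_{\mathcal X}\mathcal M^{n_1,\dots,n_D}$. -/

import Mathlib

open scoped ContDiff Matrix

noncomputable section

namespace StructuredTucker

/-- A subset `S` of a normed space is a smooth embedded submanifold if around each of its points
there is a smooth slice chart: a smooth diffeomorphism between open sets that straightens `S`
into a linear subspace. (The dimension may differ between connected components.) -/
def IsSmoothSubmanifold {E : Type*} [NormedAddCommGroup E] [NormedSpace ℝ E] (S : Set E) : Prop :=
  ∀ x ∈ S, ∃ (Φ : OpenPartialHomeomorph E E) (V : Submodule ℝ E),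
    x ∈ Φ.source ∧ ContDiffOn ℝ ∞ Φ Φ.source ∧ ContDiffOn ℝ ∞ Φ.symm Φ.target ∧
      ∀ y ∈ Φ.source, y ∈ S ↔ Φ y ∈ V

/-- The tangent space `T_x S` of `S` at `x`: all velocities at time `0` of smooth curves that run
in `S` and pass through `x` at time `0`. -/
def tangentSpaceAt {E : Type*} [NormedAddCommGroup E] [NormedSpace ℝ E] (S : Set E) (x : E) :
    Set E :=
  {v | ∃ (ε : ℝ) (γ : ℝ → E), 0 < ε ∧ ContDiffOn ℝ ∞ γ (Set.Ioo (-ε) ε) ∧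
    (∀ t ∈ Set.Ioo (-ε) ε, γ t ∈ S) ∧ γ 0 = x ∧ HasDerivAt γ v 0}

/-- The family `b` is an orthonormal basis of `T`. In particular `T` is a linear subspace. -/
def IsOrthonormalBasisOf {E ι : Type*} [NormedAddCommGroup E] [InnerProductSpace ℝ E]
    (b : ι → E) (T : Set E) : Prop :=
  Orthonormal ℝ b ∧ (Submodule.span ℝ (Set.range b) : Set E) = T

/-- Real tensors of size `n 0 × ⋯ × n (D - 1)`, with the Frobenius inner product. -/
abbrev Tensor {D : ℕ} (n : Fin D → ℕ) : Type :=
  EuclideanSpace ℝ ((d : Fin D) → Fin (n d))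

/-- The multilinear multiplication `(A_1, …, A_D) · C = (A_1 ⊗ ⋯ ⊗ A_D) C`. -/
def multilinearMul {D : ℕ} {m n : Fin D → ℕ} (A : (d : Fin D) → Matrix (Fin (m d)) (Fin (n d)) ℝ)
    (C : Tensor n) : Tensor m :=
  WithLp.toLp 2 fun i => ∑ j : (d : Fin D) → Fin (n d), (∏ d, A d (i d) (j d)) * C j

/-- The `d`th unfolding `C_(d)`: its rows are indexed by the `d`th index of `C`, its columns by the
tuple of all other indices. -/
def unfolding {D : ℕ} {n : Fin D → ℕ} (d : Fin D) (C : Tensor n) :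
    Matrix (Fin (n d)) ((e : {e : Fin D // e ≠ d}) → Fin (n e)) ℝ :=
  Matrix.of fun i k => C ((Equiv.piSplitAt d fun e => Fin (n e)).symm (i, k))

/-- A Tucker core structure: a smooth submanifold of the tensors of full multilinear rank that is
invariant under `GL(l_1) × ⋯ × GL(l_D)`. -/
structure IsTuckerCoreStructure {D : ℕ} {l : Fin D → ℕ} (M : Set (Tensor l)) : Prop where
  isSmoothSubmanifold : IsSmoothSubmanifold M
  multilinearRank : ∀ C ∈ M, ∀ d, (unfolding d C).rank = l d
  mul_mem : ∀ A : (d : Fin D) → GL (Fin (l d)) ℝ, ∀ C ∈ M,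
    multilinearMul (fun d => (A d : Matrix (Fin (l d)) (Fin (l d)) ℝ)) C ∈ M

/-- The `M`-structured Tucker manifold `M^{n_1, …, n_D}`: all tensors `(U_1, …, U_D) · C` with
`C ∈ M` and every `U_d` an `n_d × l_d` matrix of rank `l_d`. -/
def tuckerManifold {D : ℕ} {l : Fin D → ℕ} (M : Set (Tensor l)) (n : Fin D → ℕ) :
    Set (Tensor n) :=
  {X | ∃ C ∈ M, ∃ U : (d : Fin D) → Matrix (Fin (n d)) (Fin (l d)) ℝ,
    (∀ d, (U d).rank = l d) ∧ X = multilinearMul U C}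

/-- `X = (U_1, …, U_D) · C` is a compact HOSVD: for every `d` the columns of `U d` are the left
singular vectors of a compact singular value decomposition `X_(d) = U_d diag(s) Vᵀ`, with
all singular values `s j` positive. -/
structure IsHOSVD {D : ℕ} {n l : Fin D → ℕ} (X : Tensor n)
    (U : (d : Fin D) → Matrix (Fin (n d)) (Fin (l d)) ℝ) (C : Tensor l) : Prop where
  eq_mul : X = multilinearMul U C
  orthonormal : ∀ d, (U d)ᵀ * U d = 1
  compactSVD : ∀ d, ∃ (s : Fin (l d) → ℝ)
    (V : Matrix ((e : {e : Fin D // e ≠ d}) → Fin (n e)) (Fin (l d)) ℝ),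
    (∀ j, 0 < s j) ∧ Vᵀ * V = 1 ∧ unfolding d X = U d * Matrix.diagonal s * Vᵀ

/-- The columns of `[U W]` form an orthonormal basis of `ℝⁿ`. -/
def IsOrthonormalCompletion {n l k : ℕ} (U : Matrix (Fin n) (Fin l) ℝ)
    (W : Matrix (Fin n) (Fin k) ℝ) : Prop :=
  (Matrix.fromCols U W)ᵀ * Matrix.fromCols U W = 1 ∧
    Matrix.fromCols U W * (Matrix.fromCols U W)ᵀ = 1

/-- `σ_j^d`, the Euclidean norm of the `j`th row of the `d`th unfolding of `C`. -/
def rowNorm {D : ℕ} {l : Fin D → ℕ} (C : Tensor l) (d : Fin D) (j : Fin (l d)) : ℝ :=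
  ‖(WithLp.toLp 2 (unfolding d C j) : EuclideanSpace ℝ ((e : {e : Fin D // e ≠ d}) → Fin (l e)))‖

/-- The vector `û_j^d = (σ_j^d)⁻¹ e_j` of `ℝ^{l_d}`. -/
def scaledUnit {D : ℕ} {l : Fin D → ℕ} (C : Tensor l) (d : Fin D) (j : Fin (l d)) :
    Fin (l d) → ℝ :=
  (rowNorm C d j)⁻¹ • Pi.single j 1

/-- The tensor `(U_1, …, U_{d-1}, W_d e_i (û_j^d)ᵀ, U_{d+1}, …, U_D) · C`. -/
def normalDirection {D : ℕ} {n l : Fin D → ℕ} {k : Fin D → ℕ}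
    (U : (d : Fin D) → Matrix (Fin (n d)) (Fin (l d)) ℝ)
    (W : (d : Fin D) → Matrix (Fin (n d)) (Fin (k d)) ℝ) (C : Tensor l)
    (d : Fin D) (i : Fin (k d)) (j : Fin (l d)) : Tensor n :=
  multilinearMul
    (Function.update U d (Matrix.vecMulVec (W d *ᵥ Pi.single i 1) (scaledUnit C d j))) C

/-- The family that consists of the tensors `(U_1, …, U_D) · b a` and of all tensors
`(U_1, …, W_d e_i (û_j^d)ᵀ, …, U_D) · C`. -/
def tangentBasis {D : ℕ} {n l : Fin D → ℕ} {k : Fin D → ℕ} {ι : Type*}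
    (U : (d : Fin D) → Matrix (Fin (n d)) (Fin (l d)) ℝ)
    (W : (d : Fin D) → Matrix (Fin (n d)) (Fin (k d)) ℝ) (C : Tensor l) (b : ι → Tensor l) :
    ι ⊕ ((d : Fin D) × (Fin (k d) × Fin (l d))) → Tensor n :=
  Sum.elim (fun a => multilinearMul U (b a))
    (fun p => normalDirection U W C p.1 p.2.1 p.2.2)

end StructuredTucker

end

/-! Points near `X` can be written `A · c` with `c` in `M` and `U_dᵀ A_d = 1`: since `M` is
invariant under the general linear groups, the factor `U_dᵀ A_d` can be absorbed into the core. By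
the product rule the velocities at `X` are then `U · x + ∑_d (…, W_d Z_d, …) · C`, where `W_d` is
the orthonormal completion, `x` is a velocity of `M` at `C` and each `Z_d` is arbitrary.
`mem_span_tangentBasis_iff` gives the span the same shape.

Different blocks are orthogonal because their inner product contains a factor `U_dᵀ W_d = 0`. Inside
block `d` it is a trace weighted by the Gram matrix of `C_(d)`, which the HOSVD makes diagonal with
entries `(σ_j^d)²`; the scaling in `û_j^d` turns these into `1`.

The harder inclusion, `exists_of_mem_tangentSpaceAt_tuckerManifold`, recovers `c` and `A` from a
given curve by explicit differentiable formulas. -/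

noncomputable section

namespace StructuredTucker

/-! ### Kronecker products and multilinear multiplication -/

/-- The Kronecker product of a finite family of matrices. -/
def piKronecker {κ : Type*} [Fintype κ] {m n : κ → ℕ}
    (A : (d : κ) → Matrix (Fin (m d)) (Fin (n d)) ℝ) :
    Matrix ((d : κ) → Fin (m d)) ((d : κ) → Fin (n d)) ℝ :=
  Matrix.of fun i j => ∏ d, A d (i d) (j d)

section Kronecker

variable {κ : Type*} [Fintype κ] {m n p : κ → ℕ}

theorem piKronecker_mul [DecidableEq κ] (A : (d : κ) → Matrix (Fin (m d)) (Fin (n d)) ℝ)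
    (B : (d : κ) → Matrix (Fin (n d)) (Fin (p d)) ℝ) :
    piKronecker A * piKronecker B = piKronecker fun d => A d * B d := by
  ext i k
  simp only [piKronecker, Matrix.mul_apply, Matrix.of_apply, ← Finset.prod_mul_distrib]
  rw [Finset.prod_univ_sum, Fintype.piFinset_univ]

theorem piKronecker_transpose (A : (d : κ) → Matrix (Fin (m d)) (Fin (n d)) ℝ) :
    (piKronecker A)ᵀ = piKronecker fun d => (A d)ᵀ := rfl

theorem piKronecker_one :
    (piKronecker fun d => (1 : Matrix (Fin (n d)) (Fin (n d)) ℝ)) = 1 := by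
  ext i j
  simp only [piKronecker, Matrix.of_apply, Matrix.one_apply]
  rw [Finset.prod_ite_zero]
  simp [funext_iff]

end Kronecker

variable {D : ℕ} {m n l k : Fin D → ℕ}

theorem multilinearMul_eq (A : (d : Fin D) → Matrix (Fin (m d)) (Fin (n d)) ℝ) (C : Tensor n) :
    multilinearMul A C = WithLp.toLp 2 (piKronecker A *ᵥ C.ofLp) := rfl

theorem multilinearMul_apply (A : (d : Fin D) → Matrix (Fin (m d)) (Fin (n d)) ℝ) (C : Tensor n)
    (i : (d : Fin D) → Fin (m d)) :
    multilinearMul A C i = ∑ j : (d : Fin D) → Fin (n d), (∏ d, A d (i d) (j d)) * C j := rfl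

theorem multilinearMul_mul (A : (d : Fin D) → Matrix (Fin (m d)) (Fin (n d)) ℝ)
    (B : (d : Fin D) → Matrix (Fin (n d)) (Fin (l d)) ℝ) (C : Tensor l) :
    multilinearMul A (multilinearMul B C) = multilinearMul (fun d => A d * B d) C := by
  simp only [multilinearMul_eq, Matrix.mulVec_mulVec, piKronecker_mul]

theorem multilinearMul_one (C : Tensor n) : multilinearMul (fun _ => 1) C = C := by
  simp only [multilinearMul_eq, piKronecker_one, Matrix.one_mulVec]

/-- Multilinear multiplication as a linear map in the tensor. -/
def multilinearMulLin (A : (d : Fin D) → Matrix (Fin (m d)) (Fin (n d)) ℝ) :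
    Tensor n →ₗ[ℝ] Tensor m where
  toFun := multilinearMul A
  map_add' C C' := by
    simp only [multilinearMul_eq, WithLp.ofLp_add, Matrix.mulVec_add, WithLp.toLp_add]
  map_smul' c C := by
    simp only [multilinearMul_eq, WithLp.ofLp_smul, Matrix.mulVec_smul, WithLp.toLp_smul,
      RingHom.id_apply]

@[simp]
theorem multilinearMulLin_apply (A : (d : Fin D) → Matrix (Fin (m d)) (Fin (n d)) ℝ)
    (C : Tensor n) : multilinearMulLin A C = multilinearMul A C := rfl

/-- Isolating the `d`th factor makes linearity in `Z` visible, both for `modeLin` and for the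
product rule. -/
theorem prod_update_apply (A : (d : Fin D) → Matrix (Fin (m d)) (Fin (n d)) ℝ) (d : Fin D)
    (Z : Matrix (Fin (m d)) (Fin (n d)) ℝ) (i : (d : Fin D) → Fin (m d))
    (j : (d : Fin D) → Fin (n d)) :
    ∏ e, Function.update A d Z e (i e) (j e) =
      (∏ e ∈ Finset.univ.erase d, A e (i e) (j e)) * Z (i d) (j d) := by
  rw [← Finset.prod_erase_mul _ _ (Finset.mem_univ d), Function.update_self]
  congr 1
  refine Finset.prod_congr rfl fun e he => ?_
  rw [Function.update_of_ne (Finset.ne_of_mem_erase he)]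

/-- Multilinear multiplication as a linear map in the `d`th matrix. -/
def modeLin (A : (d : Fin D) → Matrix (Fin (m d)) (Fin (n d)) ℝ) (C : Tensor n) (d : Fin D) :
    Matrix (Fin (m d)) (Fin (n d)) ℝ →ₗ[ℝ] Tensor m where
  toFun Z := multilinearMul (Function.update A d Z) C
  map_add' Z Z' := by
    ext i
    simp only [multilinearMul_apply, prod_update_apply, PiLp.add_apply, Matrix.add_apply,
      ← Finset.sum_add_distrib]
    exact Finset.sum_congr rfl fun j _ => by ring
  map_smul' c Z := by
    ext i
    simp only [multilinearMul_apply, prod_update_apply, PiLp.smul_apply, Matrix.smul_apply,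
      Finset.mul_sum, smul_eq_mul, RingHom.id_apply]
    exact Finset.sum_congr rfl fun j _ => by ring

theorem modeLin_apply (A : (d : Fin D) → Matrix (Fin (m d)) (Fin (n d)) ℝ) (C : Tensor n)
    (d : Fin D) (Z : Matrix (Fin (m d)) (Fin (n d)) ℝ) :
    modeLin A C d Z = multilinearMul (Function.update A d Z) C := rfl

theorem multilinearMul_eq_zero {A : (d : Fin D) → Matrix (Fin (m d)) (Fin (n d)) ℝ} {d : Fin D}
    (hd : A d = 0) (C : Tensor n) : multilinearMul A C = 0 := by
  have h := (modeLin A C d).map_zero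
  rwa [modeLin_apply, ← hd, Function.update_eq_self] at h

theorem inner_eq_dotProduct (x y : Tensor n) : inner ℝ x y = x.ofLp ⬝ᵥ y.ofLp := by
  simp [EuclideanSpace.inner_eq_star_dotProduct, dotProduct_comm]

theorem inner_multilinearMul_left (A : (d : Fin D) → Matrix (Fin (m d)) (Fin (n d)) ℝ)
    (x : Tensor n) (y : Tensor m) :
    inner ℝ (multilinearMul A x) y = inner ℝ x (multilinearMul (fun d => (A d)ᵀ) y) := by
  simp only [inner_eq_dotProduct, multilinearMul_eq, ← piKronecker_transpose,
    Matrix.mulVec_transpose]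
  rw [dotProduct_comm, Matrix.dotProduct_mulVec, dotProduct_comm]

theorem inner_multilinearMul_multilinearMul
    (A : (d : Fin D) → Matrix (Fin (m d)) (Fin (n d)) ℝ)
    (B : (d : Fin D) → Matrix (Fin (m d)) (Fin (l d)) ℝ) (x : Tensor n) (y : Tensor l) :
    inner ℝ (multilinearMul A x) (multilinearMul B y) =
      inner ℝ x (multilinearMul (fun d => (A d)ᵀ * B d) y) := by
  rw [inner_multilinearMul_left, multilinearMul_mul]

theorem multilinearMul_transpose_cancel {A : (d : Fin D) → Matrix (Fin (m d)) (Fin (n d)) ℝ}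
    (hA : ∀ d, (A d)ᵀ * A d = 1) (C : Tensor n) :
    multilinearMul (fun d => (A d)ᵀ) (multilinearMul A C) = C := by
  rw [multilinearMul_mul]
  simp only [hA, multilinearMul_one]

/-! ### Unfoldings -/

/-- The matrices of all modes but the `d`th, multiplied as a Kronecker product. -/
def offKronecker (A : (d : Fin D) → Matrix (Fin (m d)) (Fin (n d)) ℝ) (d : Fin D) :
    Matrix ((e : {e : Fin D // e ≠ d}) → Fin (m e)) ((e : {e : Fin D // e ≠ d}) → Fin (n e)) ℝ :=
  piKronecker (m := fun e : {e : Fin D // e ≠ d} => m e) (n := fun e => n e) fun e => A e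

theorem unfolding_apply (d : Fin D) (C : Tensor n) (j : (d : Fin D) → Fin (n d)) :
    unfolding d C (j d) (fun e => j e) = C j := by
  have : (Equiv.piSplitAt d fun e => Fin (n e)).symm (j d, fun e => j e) = j :=
    (Equiv.piSplitAt d fun e => Fin (n e)).symm_apply_apply j
  simp only [unfolding, Matrix.of_apply, this]

theorem unfolding_multilinearMul (A : (d : Fin D) → Matrix (Fin (m d)) (Fin (n d)) ℝ)
    (C : Tensor n) (d : Fin D) :
    unfolding d (multilinearMul A C) = A d * unfolding d C * (offKronecker A d)ᵀ := by
  ext i k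
  -- Each row-column pair comes from one multi-index, so entries can be read off the tensor.
  obtain ⟨i, rfl, rfl⟩ : ∃ i' : (d : Fin D) → Fin (m d),
      i' d = i ∧ (fun e : {e : Fin D // e ≠ d} => i' e) = k := by
    have h := (Equiv.piSplitAt d fun e => Fin (m e)).apply_symm_apply (i, k)
    exact ⟨(Equiv.piSplitAt d fun e => Fin (m e)).symm (i, k), congrArg Prod.fst h,
      congrArg Prod.snd h⟩
  rw [unfolding_apply, multilinearMul_apply, Matrix.mul_assoc, Matrix.mul_apply]
  simp only [Matrix.mul_apply, Finset.mul_sum]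
  rw [← Fintype.sum_prod_type'
    (f := fun a b => A d (i d) a * (unfolding d C a b * (offKronecker A d)ᵀ b fun e => i e))]
  refine Fintype.sum_equiv (Equiv.piSplitAt d fun e => Fin (n e)) _ _ fun j => ?_
  simp only [Equiv.piSplitAt_apply, unfolding_apply, offKronecker, piKronecker,
    Matrix.transpose_apply, Matrix.of_apply]
  rw [← Finset.mul_prod_erase _ _ (Finset.mem_univ d),
    ← Finset.prod_subtype (Finset.univ.erase d) (by simp) fun e => A e (i e) (j e)]
  ring

theorem offKronecker_transpose_mul {A : (d : Fin D) → Matrix (Fin (m d)) (Fin (n d)) ℝ}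
    (hA : ∀ d, (A d)ᵀ * A d = 1) (d : Fin D) :
    (offKronecker A d)ᵀ * offKronecker A d = 1 := by
  rw [offKronecker, piKronecker_transpose, piKronecker_mul]
  simp only [hA, piKronecker_one]

/-- The inner product of a tensor with a mode-`d` product, through the unfoldings. -/
theorem inner_multilinearMul_update_one (d : Fin D) (B : Matrix (Fin (n d)) (Fin (n d)) ℝ)
    (x y : Tensor n) :
    inner ℝ x (multilinearMul
      (Function.update (fun e => (1 : Matrix (Fin (n e)) (Fin (n e)) ℝ)) d B) y) =
      ((unfolding d x)ᵀ * (B * unfolding d y)).trace := by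
  have h : B * unfolding d y = unfolding d (multilinearMul
      (Function.update (fun e => (1 : Matrix (Fin (n e)) (Fin (n e)) ℝ)) d B) y) := by
    rw [unfolding_multilinearMul, Function.update_self]
    have : offKronecker (Function.update (fun e => (1 : Matrix (Fin (n e)) (Fin (n e)) ℝ)) d B) d
        = 1 := by
      rw [offKronecker, ← piKronecker_one]
      congr 1
      funext e
      rw [Function.update_of_ne e.2]
    rw [this, Matrix.transpose_one, Matrix.mul_one]
  rw [h]
  generalize multilinearMul _ y = z
  rw [inner_eq_dotProduct]
  simp only [Matrix.trace, Matrix.diag, Matrix.mul_apply, Matrix.transpose_apply, dotProduct]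
  rw [Finset.sum_comm,
    ← Fintype.sum_prod_type' (f := fun a b => unfolding d x a b * unfolding d z a b)]
  refine Fintype.sum_equiv (Equiv.piSplitAt d fun e => Fin (n e)) _ _ fun j => ?_
  simp only [Equiv.piSplitAt_apply, unfolding_apply]

theorem IsOrthonormalCompletion.transpose_mul_self {n l k : ℕ} {U : Matrix (Fin n) (Fin l) ℝ}
    {W : Matrix (Fin n) (Fin k) ℝ} (h : IsOrthonormalCompletion U W) : Uᵀ * W = 0 ∧ Wᵀ * W = 1 := by
  have h1 := h.1
  rw [Matrix.transpose_fromCols, Matrix.fromRows_mul_fromCols, ← Matrix.fromBlocks_one,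
    Matrix.fromBlocks_inj] at h1
  exact ⟨h1.2.1, h1.2.2.2⟩

theorem IsOrthonormalCompletion.mul_transpose_add {n l k : ℕ} {U : Matrix (Fin n) (Fin l) ℝ}
    {W : Matrix (Fin n) (Fin k) ℝ} (h : IsOrthonormalCompletion U W) :
    U * Uᵀ + W * Wᵀ = 1 := by
  have h1 := h.2
  rwa [Matrix.transpose_fromCols, Matrix.fromCols_mul_fromRows] at h1

/-! ### The core of an HOSVD has orthogonal rows -/

theorem rowNorm_sq (C : Tensor l) (d : Fin D) (j : Fin (l d)) :
    rowNorm C d j ^ 2 = (unfolding d C * (unfolding d C)ᵀ) j j := by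
  rw [rowNorm, EuclideanSpace.real_norm_sq_eq]
  simp [Matrix.mul_apply, pow_two]

namespace IsHOSVD

variable {X : Tensor n} {U : (d : Fin D) → Matrix (Fin (n d)) (Fin (l d)) ℝ} {C : Tensor l}

/-- The orthonormal columns of `U d` and of the off-mode Kronecker product cancel, so the singular
value decomposition of `X_(d)` descends to the core. -/
theorem exists_unfolding_mul_transpose (h : IsHOSVD X U C) (d : Fin D) :
    ∃ s : Fin (l d) → ℝ, (∀ j, 0 < s j) ∧
      unfolding d C * (unfolding d C)ᵀ = Matrix.diagonal fun j => s j * s j := by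
  obtain ⟨s, V, hs, hV, hX⟩ := h.compactSVD d
  refine ⟨s, hs, ?_⟩
  rw [h.eq_mul, unfolding_multilinearMul] at hX
  have hK := offKronecker_transpose_mul h.orthonormal d
  have hU := h.orthonormal d
  set K := offKronecker U d
  set Y := unfolding d C
  have h1 : Y * Kᵀ = Matrix.diagonal s * Vᵀ := by
    have := congrArg (fun Z => (U d)ᵀ * Z) hX
    simpa only [← Matrix.mul_assoc, hU, Matrix.one_mul] using this
  calc Y * Yᵀ = Y * (Kᵀ * K) * Yᵀ := by rw [hK, Matrix.mul_one]
    _ = (Y * Kᵀ) * (Y * Kᵀ)ᵀ := by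
      simp only [Matrix.transpose_mul, Matrix.transpose_transpose, Matrix.mul_assoc]
    _ = Matrix.diagonal s * (Vᵀ * V) * Matrix.diagonal s := by
      rw [h1]
      simp only [Matrix.transpose_mul, Matrix.transpose_transpose, Matrix.mul_assoc,
        Matrix.diagonal_transpose]
    _ = _ := by rw [hV, Matrix.mul_one, Matrix.diagonal_mul_diagonal]

theorem rowNorm_pos (h : IsHOSVD X U C) (d : Fin D) (j : Fin (l d)) : 0 < rowNorm C d j := by
  obtain ⟨s, hs, hC⟩ := h.exists_unfolding_mul_transpose d
  have h1 := rowNorm_sq C d j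
  rw [hC, Matrix.diagonal_apply_eq] at h1
  have h2 : 0 < rowNorm C d j ^ 2 := h1 ▸ mul_pos (hs j) (hs j)
  exact (norm_nonneg _).lt_of_ne' fun h0 => by
    rw [show rowNorm C d j = 0 from h0] at h2
    simp at h2

theorem unfolding_mul_transpose (h : IsHOSVD X U C) (d : Fin D) :
    unfolding d C * (unfolding d C)ᵀ = Matrix.diagonal fun j => rowNorm C d j ^ 2 := by
  obtain ⟨s, -, hC⟩ := h.exists_unfolding_mul_transpose d
  simp only [rowNorm_sq, hC, Matrix.diagonal_apply_eq]

theorem transpose_multilinearMul (h : IsHOSVD X U C) :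
    multilinearMul (fun d => (U d)ᵀ) X = C := by
  rw [h.eq_mul, multilinearMul_transpose_cancel h.orthonormal]

end IsHOSVD

/-! ### Orthonormality of the family -/

theorem inner_multilinearMul_update_same {U : (d : Fin D) → Matrix (Fin (n d)) (Fin (l d)) ℝ}
    (hU : ∀ d, (U d)ᵀ * U d = 1) (C : Tensor l) (d : Fin D)
    (Z Z' : Matrix (Fin (n d)) (Fin (l d)) ℝ) :
    inner ℝ (multilinearMul (Function.update U d Z) C)
      (multilinearMul (Function.update U d Z') C) =
      (Zᵀ * Z' * (unfolding d C * (unfolding d C)ᵀ)).trace := by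
  rw [inner_multilinearMul_multilinearMul]
  have : (fun e => (Function.update U d Z e)ᵀ * Function.update U d Z' e) =
      Function.update (fun e => (1 : Matrix (Fin (l e)) (Fin (l e)) ℝ)) d (Zᵀ * Z') := by
    funext e
    rcases eq_or_ne e d with rfl | he
    · simp only [Function.update_self]
    · simp only [Function.update_of_ne he, hU]
  rw [this, inner_multilinearMul_update_one, Matrix.trace_mul_comm, Matrix.mul_assoc]

/-- One vanishing factor kills the whole product. Taking `A = U` separates core directions from
normal ones; taking `U` altered in another mode separates two modes. -/
theorem inner_multilinearMul_update_eq_zero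
    {U A : (d : Fin D) → Matrix (Fin (n d)) (Fin (l d)) ℝ} {d : Fin D}
    {Z : Matrix (Fin (n d)) (Fin (l d)) ℝ} (hZ : (A d)ᵀ * Z = 0) (x y : Tensor l) :
    inner ℝ (multilinearMul A x) (multilinearMul (Function.update U d Z) y) = 0 := by
  rw [inner_multilinearMul_multilinearMul, multilinearMul_eq_zero (d := d), inner_zero_right]
  rw [Function.update_self, hZ]

theorem mul_vecMulVec_eq_zero {n l k p : ℕ} {U : Matrix (Fin n) (Fin l) ℝ}
    {W : Matrix (Fin n) (Fin k) ℝ} (h : Uᵀ * W = 0) (x : Fin k → ℝ) (y : Fin p → ℝ) :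
    Uᵀ * Matrix.vecMulVec (W *ᵥ x) y = 0 := by
  rw [Matrix.mul_vecMulVec, Matrix.mulVec_mulVec, h, Matrix.zero_mulVec, Matrix.zero_vecMulVec]

theorem inner_normalDirection_same {X : Tensor n}
    {U : (d : Fin D) → Matrix (Fin (n d)) (Fin (l d)) ℝ} {C : Tensor l} (h : IsHOSVD X U C)
    {W : (d : Fin D) → Matrix (Fin (n d)) (Fin (k d)) ℝ} {d : Fin D} (hW : (W d)ᵀ * W d = 1)
    (i i' : Fin (k d)) (j j' : Fin (l d)) :
    inner ℝ (normalDirection U W C d i j) (normalDirection U W C d i' j') =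
      if i = i' ∧ j = j' then 1 else 0 := by
  have hij : (W d *ᵥ Pi.single i 1) ⬝ᵥ (W d *ᵥ Pi.single i' 1) = if i = i' then (1 : ℝ) else 0 := by
    rw [Matrix.dotProduct_mulVec, ← Matrix.mulVec_transpose, Matrix.mulVec_mulVec, hW,
      Matrix.one_mulVec]
    simp [Pi.single_apply, eq_comm]
  rw [normalDirection, normalDirection, inner_multilinearMul_update_same h.orthonormal,
    h.unfolding_mul_transpose, Matrix.transpose_vecMulVec, Matrix.vecMulVec_mul_vecMulVec, hij]
  have hj := (h.rowNorm_pos d j).ne'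
  simp only [Matrix.trace, Matrix.diag, Matrix.mul_diagonal, Matrix.vecMulVec_apply,
    scaledUnit, Pi.smul_apply, Pi.single_apply, smul_eq_mul]
  -- `û_j` is supported at `j`, so one diagonal entry survives; for equal indices it is `σ_j⁻² σ_j²
  -- = 1`.
  rw [Finset.sum_eq_single j]
  · rcases eq_or_ne j j' with rfl | hne
    · by_cases hi : i = i' <;> simp [hi]
      field_simp
    · simp [hne]
  · intro b _ hb
    simp [hb]
  · simp

theorem orthonormal_tangentBasis {X : Tensor n}
    {U : (d : Fin D) → Matrix (Fin (n d)) (Fin (l d)) ℝ} {C : Tensor l} (h : IsHOSVD X U C)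
    {W : (d : Fin D) → Matrix (Fin (n d)) (Fin (k d)) ℝ}
    (hW : ∀ d, IsOrthonormalCompletion (U d) (W d)) {ι : Type*} {b : ι → Tensor l}
    (hb : Orthonormal ℝ b) : Orthonormal ℝ (tangentBasis U W C b) := by
  classical
  have hUW := fun d => (hW d).transpose_mul_self.1
  have hWW := fun d => (hW d).transpose_mul_self.2
  rw [orthonormal_iff_ite] at hb ⊢
  have hmix : ∀ a (p : (d : Fin D) × (Fin (k d) × Fin (l d))),
      inner ℝ (multilinearMul U (b a)) (normalDirection U W C p.1 p.2.1 p.2.2) = 0 := fun a p =>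
    inner_multilinearMul_update_eq_zero (mul_vecMulVec_eq_zero (hUW p.1) _ _) _ _
  rintro (a | ⟨d, i, j⟩) (a' | ⟨d', i', j'⟩)
  · simp only [tangentBasis, Sum.elim_inl, Sum.inl.injEq]
    rw [inner_multilinearMul_multilinearMul]
    simp only [h.orthonormal, multilinearMul_one, hb]
  · simpa [tangentBasis] using hmix a ⟨d', i', j'⟩
  · rw [real_inner_comm]
    simpa [tangentBasis] using hmix a' ⟨d, i, j⟩
  · simp only [tangentBasis, Sum.elim_inr, Sum.inr.injEq]
    rcases eq_or_ne d d' with rfl | hd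
    · rw [inner_normalDirection_same h (hWW d)]
      simp
    · rw [if_neg (by simp [hd])]
      refine inner_multilinearMul_update_eq_zero ?_ _ _
      rw [Function.update_of_ne hd.symm]
      exact mul_vecMulVec_eq_zero (hUW d') _ _

/-! ### The span of the family -/

section Span

variable {U : (d : Fin D) → Matrix (Fin (n d)) (Fin (l d)) ℝ}
  {W : (d : Fin D) → Matrix (Fin (n d)) (Fin (k d)) ℝ} {C : Tensor l}
  {ι : Type*} {b : ι → Tensor l}

theorem normalDirection_eq (U : (d : Fin D) → Matrix (Fin (n d)) (Fin (l d)) ℝ)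
    (W : (d : Fin D) → Matrix (Fin (n d)) (Fin (k d)) ℝ) (C : Tensor l) (d : Fin D)
    (i : Fin (k d)) (j : Fin (l d)) :
    normalDirection U W C d i j =
      modeLin U C d (W d * ((rowNorm C d j)⁻¹ • Matrix.single i j (1 : ℝ))) := by
  rw [normalDirection, modeLin_apply]
  congr 2
  rw [← Matrix.mul_vecMulVec, Matrix.single_eq_single_vecMulVec_single, scaledUnit,
    Matrix.vecMulVec_smul]

/-- Matrix units span all `Z`, and the nonzero `σ_j^d` undo the normalisation. -/
theorem modeLin_mem_span_tangentBasis (hC : ∀ d j, rowNorm C d j ≠ 0) (b : ι → Tensor l)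
    (d : Fin D) (Z : Matrix (Fin (k d)) (Fin (l d)) ℝ) :
    modeLin U C d (W d * Z) ∈ Submodule.span ℝ (Set.range (tangentBasis U W C b)) := by
  rw [Matrix.matrix_eq_sum_single Z]
  simp only [Matrix.mul_sum, map_sum]
  refine Submodule.sum_mem _ fun i _ => Submodule.sum_mem _ fun j _ => ?_
  have h : modeLin U C d (W d * Matrix.single i j (Z i j)) =
      (Z i j * rowNorm C d j) • normalDirection U W C d i j := by
    rw [normalDirection_eq, ← map_smul, ← Matrix.mul_smul, smul_smul, mul_assoc,
      mul_inv_cancel₀ (hC d j), mul_one, Matrix.smul_single, smul_eq_mul, mul_one]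
  rw [h]
  exact Submodule.smul_mem _ _ (Submodule.subset_span ⟨Sum.inr ⟨d, i, j⟩, rfl⟩)

theorem multilinearMul_mem_span_tangentBasis {x : Tensor l}
    (hx : x ∈ Submodule.span ℝ (Set.range b)) :
    multilinearMul U x ∈ Submodule.span ℝ (Set.range (tangentBasis U W C b)) := by
  have h : Submodule.span ℝ (Set.range b) ≤
      (Submodule.span ℝ (Set.range (tangentBasis U W C b))).comap (multilinearMulLin U) := by
    rw [Submodule.span_le]
    rintro _ ⟨a, rfl⟩
    exact Submodule.subset_span ⟨Sum.inl a, rfl⟩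
  exact h hx

theorem mem_span_tangentBasis_iff (hC : ∀ d j, rowNorm C d j ≠ 0) {v : Tensor n} :
    v ∈ Submodule.span ℝ (Set.range (tangentBasis U W C b)) ↔
      ∃ x ∈ Submodule.span ℝ (Set.range b), ∃ Z : (d : Fin D) → Matrix (Fin (k d)) (Fin (l d)) ℝ,
        v = multilinearMulLin U x + ∑ d, modeLin U C d (W d * Z d) := by
  constructor
  · intro hv
    induction hv using Submodule.span_induction with
    | mem v hv =>
      obtain ⟨a | ⟨d, i, j⟩, rfl⟩ := hv
      · exact ⟨b a, Submodule.subset_span ⟨a, rfl⟩, 0, by simp [tangentBasis]⟩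
      · refine ⟨0, zero_mem _, Pi.single d ((rowNorm C d j)⁻¹ • Matrix.single i j (1 : ℝ)), ?_⟩
        rw [map_zero, zero_add, Finset.sum_eq_single d]
        · rw [Pi.single_eq_same, ← normalDirection_eq]
          rfl
        · intro e _ he
          rw [Pi.single_eq_of_ne he, Matrix.mul_zero, map_zero]
        · simp
    | zero =>
      exact ⟨0, zero_mem _, 0, by simp only [map_zero, Pi.zero_apply, Matrix.mul_zero,
        Finset.sum_const_zero, add_zero]⟩
    | add v v' _ _ hv hv' =>
      obtain ⟨x, hx, Z, rfl⟩ := hv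
      obtain ⟨x', hx', Z', rfl⟩ := hv'
      refine ⟨x + x', add_mem hx hx', Z + Z', ?_⟩
      simp only [map_add, Pi.add_apply, Matrix.mul_add, Finset.sum_add_distrib]
      abel
    | smul c v _ hv =>
      obtain ⟨x, hx, Z, rfl⟩ := hv
      refine ⟨c • x, Submodule.smul_mem _ c hx, c • Z, ?_⟩
      simp only [map_smul, Pi.smul_apply, Matrix.mul_smul, smul_add, Finset.smul_sum]
  · rintro ⟨x, hx, Z, rfl⟩
    exact add_mem (multilinearMul_mem_span_tangentBasis hx)
      (Submodule.sum_mem _ fun d _ => modeLin_mem_span_tangentBasis hC b d (Z d))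

end Span

/-! ### Product rule and differentiability of matrix inverses -/

section Calculus

theorem hasDerivAt_multilinearMul {A : ℝ → (d : Fin D) → Matrix (Fin (n d)) (Fin (l d)) ℝ}
    {A' : (d : Fin D) → Matrix (Fin (n d)) (Fin (l d)) ℝ} {c : ℝ → Tensor l} {c' : Tensor l}
    {t : ℝ} (hA : ∀ d i j, HasDerivAt (fun s => A s d i j) (A' d i j) t)
    (hc : HasDerivAt c c' t) :
    HasDerivAt (fun s => multilinearMul (A s) (c s))
      (multilinearMul (A t) c' + ∑ d, multilinearMul (Function.update (A t) d (A' d)) (c t)) t := by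
  have hcj : ∀ j, HasDerivAt (fun s => c s j) (c' j) t := fun j =>
    (EuclideanSpace.proj (𝕜 := ℝ) j).hasFDerivAt.comp_hasDerivAt t hc
  have key : HasDerivAt (fun s => (multilinearMul (A s) (c s)).ofLp)
      (multilinearMul (A t) c' +
        ∑ d, multilinearMul (Function.update (A t) d (A' d)) (c t)).ofLp t := by
    rw [hasDerivAt_pi]
    intro i
    simp only [multilinearMul_apply]
    have h := HasDerivAt.fun_sum (u := Finset.univ) fun (j : (d : Fin D) → Fin (l d)) _ =>
      (HasDerivAt.fun_finsetProd (u := Finset.univ) fun d _ => hA d (i d) (j d)).mul (hcj j)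
    refine h.congr_deriv ?_
    simp only [PiLp.add_apply, WithLp.ofLp_sum, Finset.sum_apply, multilinearMul_apply,
      prod_update_apply, smul_eq_mul, Finset.sum_add_distrib, Finset.sum_mul]
    rw [add_comm]
    congr 1
    exact Finset.sum_comm
  exact (EuclideanSpace.equiv _ ℝ).symm.toContinuousLinearMap.hasFDerivAt.comp_hasDerivAt t key

theorem contDiffOn_multilinearMul {A : ℝ → (d : Fin D) → Matrix (Fin (n d)) (Fin (l d)) ℝ}
    {c : ℝ → Tensor l} {s : Set ℝ} {N : WithTop ℕ∞}
    (hA : ∀ d i j, ContDiffOn ℝ N (fun t => A t d i j) s) (hc : ContDiffOn ℝ N c s) :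
    ContDiffOn ℝ N (fun t => multilinearMul (A t) (c t)) s := by
  rw [contDiffOn_euclidean] at hc ⊢
  intro i
  simp only [multilinearMul_apply]
  exact ContDiffOn.sum fun j _ => (contDiffOn_prod fun d _ => hA d (i d) (j d)).mul (hc j)

variable {p q r : Type*} [Fintype q] {t : ℝ}

theorem differentiableAt_mul_apply {A : ℝ → Matrix p q ℝ} {B : ℝ → Matrix q r ℝ}
    (hA : ∀ i j, DifferentiableAt ℝ (fun s => A s i j) t)
    (hB : ∀ i j, DifferentiableAt ℝ (fun s => B s i j) t) (i : p) (j : r) :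
    DifferentiableAt ℝ (fun s => (A s * B s) i j) t := by
  simp only [Matrix.mul_apply]
  exact DifferentiableAt.fun_sum fun a _ => (hA i a).mul (hB a j)

variable [DecidableEq q]

theorem differentiableAt_det {A : ℝ → Matrix q q ℝ}
    (hA : ∀ i j, DifferentiableAt ℝ (fun s => A s i j) t) :
    DifferentiableAt ℝ (fun s => (A s).det) t := by
  simp only [Matrix.det_apply]
  exact DifferentiableAt.fun_sum fun a _ => (DifferentiableAt.fun_finsetProd fun i _ =>
    hA (a i) i).const_smul _

/-- By Cramer's rule the entries are cofactors divided by the determinant. -/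
theorem differentiableAt_inv_apply {A : ℝ → Matrix q q ℝ}
    (hA : ∀ i j, DifferentiableAt ℝ (fun s => A s i j) t) (h0 : (A t).det ≠ 0) (i j : q) :
    DifferentiableAt ℝ (fun s => (A s)⁻¹ i j) t := by
  simp only [Matrix.inv_def, Ring.inverse_eq_inv', Matrix.smul_apply, smul_eq_mul,
    Matrix.adjugate_apply]
  refine ((differentiableAt_det hA).inv h0).mul (differentiableAt_det fun a b => ?_)
  simp only [Matrix.updateRow_apply]
  split_ifs
  · exact differentiableAt_const _
  · exact hA a b

end Calculus

/-! ### Curves in the structured Tucker manifold -/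

section Tangent

variable {M : Set (Tensor l)}

theorem rank_eq_of_mul_eq_one {n l : ℕ} {A : Matrix (Fin n) (Fin l) ℝ}
    {B : Matrix (Fin l) (Fin n) ℝ} (h : B * A = 1) : A.rank = l := by
  refine le_antisymm A.rank_le_width ?_
  have := Matrix.rank_mul_le_right B A
  rwa [h, Matrix.rank_one, Fintype.card_fin] at this

/-- The curve `(U + t W Z) · γ(t)` has this velocity; `U_dᵀ` is a left inverse of each factor for
every `t`, so the rank never drops. -/
theorem multilinearMul_add_sum_mem_tangentSpaceAt
    {U : (d : Fin D) → Matrix (Fin (n d)) (Fin (l d)) ℝ}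
    {W : (d : Fin D) → Matrix (Fin (n d)) (Fin (k d)) ℝ}
    (hU : ∀ d, (U d)ᵀ * U d = 1) (hW : ∀ d, (U d)ᵀ * W d = 0) {C x : Tensor l}
    (hx : x ∈ tangentSpaceAt M C) (Z : (d : Fin D) → Matrix (Fin (k d)) (Fin (l d)) ℝ) :
    multilinearMul U x + ∑ d, multilinearMul (Function.update U d (W d * Z d)) C ∈
      tangentSpaceAt (tuckerManifold M n) (multilinearMul U C) := by
  obtain ⟨ε, γ, hε, hγ, hM, rfl, hd⟩ := hx
  let A : ℝ → (d : Fin D) → Matrix (Fin (n d)) (Fin (l d)) ℝ := fun t d => U d + t • (W d * Z d)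
  have hA0 : A 0 = U := by
    funext d
    simp only [A, zero_smul, add_zero]
  refine ⟨ε, fun t => multilinearMul (A t) (γ t), hε, ?_, ?_, ?_, ?_⟩
  · refine contDiffOn_multilinearMul (fun d i j => ?_) hγ
    simp only [A, Matrix.add_apply, Matrix.smul_apply, smul_eq_mul]
    exact (contDiff_const.add (contDiff_id.mul contDiff_const)).contDiffOn
  · intro t ht
    refine ⟨γ t, hM t ht, A t, fun d => rank_eq_of_mul_eq_one (B := (U d)ᵀ) ?_, rfl⟩
    simp only [A, Matrix.mul_add, Matrix.mul_smul, ← Matrix.mul_assoc, hU, hW, Matrix.zero_mul,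
      smul_zero, add_zero]
  · simp only [hA0]
  · have h := hasDerivAt_multilinearMul (A := A) (A' := fun d => W d * Z d) (t := 0)
      (fun d i j => ?_) hd
    · simpa only [hA0] using h
    · simp only [A, Matrix.add_apply, Matrix.smul_apply, smul_eq_mul]
      simpa using ((hasDerivAt_id (0 : ℝ)).mul_const ((W d * Z d) i j)).const_add (U d i j)

/-- A point of the structured Tucker manifold is recovered from its coordinates in the frame `U`
if these have full multilinear rank. -/
theorem exists_eq_multilinearMul_of_mem_tuckerManifold (hM : IsTuckerCoreStructure M)
    {Y : Tensor n} (hY : Y ∈ tuckerManifold M n)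
    (U : (d : Fin D) → Matrix (Fin (n d)) (Fin (l d)) ℝ)
    (R : (d : Fin D) → Matrix ((e : {e : Fin D // e ≠ d}) → Fin (l e)) (Fin (l d)) ℝ)
    (hR : ∀ d, (unfolding d (multilinearMul (fun e => (U e)ᵀ) Y) * R d).det ≠ 0) :
    multilinearMul (fun e => (U e)ᵀ) Y ∈ M ∧
      ∃ A : (d : Fin D) → Matrix (Fin (n d)) (Fin (l d)) ℝ, (∀ d, (U d)ᵀ * A d = 1) ∧
        Y = multilinearMul A (multilinearMul (fun e => (U e)ᵀ) Y) := by
  obtain ⟨C', hC', V, -, rfl⟩ := hY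
  rw [multilinearMul_mul] at hR ⊢
  -- The unfolding has `U_dᵀ V_d` as its left factor, so the nonzero determinant splits off that of
  -- `U_dᵀ V_d`.
  have hdet : ∀ d, IsUnit ((U d)ᵀ * V d).det := by
    intro d
    have h := hR d
    rw [unfolding_multilinearMul, Matrix.mul_assoc, Matrix.mul_assoc, Matrix.det_mul] at h
    exact (left_ne_zero_of_mul h).isUnit
  refine ⟨hM.mul_mem (fun d => Matrix.GeneralLinearGroup.mk'' _ (hdet d)) C' hC',
    fun d => V d * ((U d)ᵀ * V d)⁻¹, fun d => ?_, ?_⟩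
  · rw [← Matrix.mul_assoc, Matrix.mul_nonsing_inv _ (hdet d)]
  · rw [multilinearMul_mul]
    congr 1
    funext d
    rw [Matrix.mul_assoc, Matrix.nonsing_inv_mul _ (hdet d), Matrix.mul_one]

/-- The relations `A_eᵀ U_e = 1` strip off all modes but `d`, which allows solving for `A_d`. -/
theorem mul_unfolding_eq {U A : (d : Fin D) → Matrix (Fin (n d)) (Fin (l d)) ℝ}
    (hA : ∀ d, (U d)ᵀ * A d = 1) (C : Tensor l) (d : Fin D) :
    unfolding d (multilinearMul A C) * offKronecker U d = A d * unfolding d C := by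
  have h : (offKronecker A d)ᵀ * offKronecker U d = 1 := by
    rw [offKronecker, offKronecker, piKronecker_transpose, piKronecker_mul]
    have hA' : ∀ d, (A d)ᵀ * U d = 1 := fun d => by
      rw [← Matrix.transpose_one, ← hA d, Matrix.transpose_mul, Matrix.transpose_transpose]
    simp only [hA', piKronecker_one]
  rw [unfolding_multilinearMul, Matrix.mul_assoc, h, Matrix.mul_one]

/-- The Gram matrix `G` of the rows of `C_(d)` is diagonal and invertible, so `C_(d)ᵀ G⁻¹` is a
right inverse. -/
theorem IsHOSVD.exists_unfolding_mul_eq_one {X : Tensor n}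
    {U : (d : Fin D) → Matrix (Fin (n d)) (Fin (l d)) ℝ} {C : Tensor l} (h : IsHOSVD X U C)
    (d : Fin D) : 
    ∃ R : Matrix ((e : {e : Fin D // e ≠ d}) → Fin (l e)) (Fin (l d)) ℝ, unfolding d C * R = 1 := by
  refine ⟨(unfolding d C)ᵀ * Matrix.diagonal fun j => (rowNorm C d j ^ 2)⁻¹, ?_⟩
  rw [← Matrix.mul_assoc, h.unfolding_mul_transpose, Matrix.diagonal_mul_diagonal,
    ← Matrix.diagonal_one]
  congr 1
  funext j
  exact mul_inv_cancel₀ (pow_ne_zero 2 (h.rowNorm_pos d j).ne')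

theorem exists_of_mem_tangentSpaceAt_tuckerManifold (hM : IsTuckerCoreStructure M)
    {X : Tensor n} {U : (d : Fin D) → Matrix (Fin (n d)) (Fin (l d)) ℝ} {C : Tensor l}
    (h : IsHOSVD X U C) {W : (d : Fin D) → Matrix (Fin (n d)) (Fin (k d)) ℝ}
    (hW : ∀ d, IsOrthonormalCompletion (U d) (W d)) {v : Tensor n}
    (hv : v ∈ tangentSpaceAt (tuckerManifold M n) X) :
    ∃ x ∈ tangentSpaceAt M C, ∃ Z : (d : Fin D) → Matrix (Fin (k d)) (Fin (l d)) ℝ,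
      v = multilinearMul U x + ∑ d, multilinearMul (Function.update U d (W d * Z d)) C := by
  obtain ⟨ε, γ, hε, hγ, hγM, hγ0, hγd⟩ := hv
  choose R hR using h.exists_unfolding_mul_eq_one
  let L : Tensor n →L[ℝ] Tensor l :=
    (multilinearMulLin fun d => (U d)ᵀ).toContinuousLinearMap
  let c : ℝ → Tensor l := fun t => multilinearMul (fun d => (U d)ᵀ) (γ t)
  have hc0 : c 0 = C := by
    simp only [c, hγ0, h.transpose_multilinearMul]
  have hcd : HasDerivAt c (multilinearMul (fun d => (U d)ᵀ) v) 0 :=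
    L.hasFDerivAt.comp_hasDerivAt 0 hγd
  have hunf : ∀ {m : Fin D → ℕ} {f : ℝ → Tensor m} {f' : Tensor m}, HasDerivAt f f' 0 →
      ∀ d i j, DifferentiableAt ℝ (fun t => unfolding d (f t) i j) 0 := fun hf d i j =>
    differentiableAt_euclidean.1 hf.differentiableAt _
  -- With `R` fixed, `N` is `1` at time `0`, hence invertible nearby; this certifies full
  -- multilinear rank of `c t`.
  let N : ℝ → (d : Fin D) → Matrix (Fin (l d)) (Fin (l d)) ℝ := fun t d => unfolding d (c t) * R d
  have hN0 : ∀ d, N 0 d = 1 := fun d => by simp only [N, hc0, hR]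
  have hNd : ∀ d i j, DifferentiableAt ℝ (fun t => N t d i j) 0 := fun d =>
    differentiableAt_mul_apply (hunf hcd d) fun _ _ => differentiableAt_const _
  have hdet : ∀ᶠ t in nhds (0 : ℝ), ∀ d, (N t d).det ≠ 0 := by
    rw [Filter.eventually_all]
    intro d
    refine (differentiableAt_det (hNd d)).continuousAt.eventually_ne ?_
    simp only [hN0, Matrix.det_one]
    exact one_ne_zero
  obtain ⟨δ', hδ', hball⟩ := Metric.eventually_nhds_iff.1 hdet
  let δ := min ε δ'
  have hδ : 0 < δ := lt_min hε hδ'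
  have hsub : Set.Ioo (-δ) δ ⊆ Set.Ioo (-ε) ε :=
    Set.Ioo_subset_Ioo (neg_le_neg (min_le_left _ _)) (min_le_left _ _)
  have hδdet : ∀ t ∈ Set.Ioo (-δ) δ, ∀ d, (N t d).det ≠ 0 := fun t ht => hball (by
    rw [Real.dist_eq, sub_zero]
    exact (abs_lt.2 ht).trans_le (min_le_right _ _))
  have hrec : ∀ t ∈ Set.Ioo (-δ) δ, c t ∈ M ∧
      ∃ A : (d : Fin D) → Matrix (Fin (n d)) (Fin (l d)) ℝ, (∀ d, (U d)ᵀ * A d = 1) ∧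
        γ t = multilinearMul A (c t) := fun t ht =>
    exists_eq_multilinearMul_of_mem_tuckerManifold hM (hγM t (hsub ht)) U R (hδdet t ht)
  have hnhds : Set.Ioo (-δ) δ ∈ nhds (0 : ℝ) := Ioo_mem_nhds (neg_lt_zero.2 hδ) hδ
  choose hcM A hUA hγA using hrec
  -- The chosen `A` carries no regularity. Solving `γ_(d) K R = A_d c_(d) R = A_d N`, with `K` the
  -- off-mode Kronecker product of `U`, gives a differentiable formula for it.
  let A₁ : ℝ → (d : Fin D) → Matrix (Fin (n d)) (Fin (l d)) ℝ := fun t d =>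
    unfolding d (γ t) * offKronecker U d * R d * (N t d)⁻¹
  have hAeq : ∀ t (ht : t ∈ Set.Ioo (-δ) δ), A t ht = A₁ t := by
    intro t ht
    funext d
    have h1 := mul_unfolding_eq (hUA t ht) (c t) d
    rw [← hγA t ht] at h1
    simp only [A₁, h1]
    rw [Matrix.mul_assoc (A t ht d)]
    exact (Matrix.mul_nonsing_inv_cancel_right _ _ (hδdet t ht d).isUnit).symm
  have hA0 : A₁ 0 = U := by
    funext d
    simp only [A₁, hN0, hγ0, inv_one, Matrix.mul_one]
    rw [h.eq_mul, mul_unfolding_eq h.orthonormal, Matrix.mul_assoc, hR, Matrix.mul_one]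
  have hAd : ∀ d i j, DifferentiableAt ℝ (fun t => A₁ t d i j) 0 := fun d =>
    differentiableAt_mul_apply
      (differentiableAt_mul_apply (differentiableAt_mul_apply (hunf hγd d) fun _ _ =>
        differentiableAt_const _) fun _ _ => differentiableAt_const _)
      (differentiableAt_inv_apply (hNd d) (by rw [hN0, Matrix.det_one]; exact one_ne_zero))
  let A' : (d : Fin D) → Matrix (Fin (n d)) (Fin (l d)) ℝ := fun d =>
    Matrix.of fun i j => deriv (fun t => A₁ t d i j) 0
  have hA' : ∀ d i j, HasDerivAt (fun t => A₁ t d i j) (A' d i j) 0 := fun d i j =>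
    (hAd d i j).hasDerivAt
  -- `U_dᵀ A_d` is constantly `1` near `0`, so its derivative vanishes; with `U Uᵀ + W Wᵀ = 1` this
  -- puts the columns of `A'` in the range of `W`.
  have hUA' : ∀ d, (U d)ᵀ * A' d = 0 := by
    intro d
    ext i j
    have h1 : HasDerivAt (fun t => ((U d)ᵀ * A₁ t d) i j) (((U d)ᵀ * A' d) i j) 0 := by
      simp only [Matrix.mul_apply]
      exact HasDerivAt.fun_sum fun a _ => (hA' d a j).const_mul _
    have h2 : (fun t => ((U d)ᵀ * A₁ t d) i j) =ᶠ[nhds 0]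
        fun _ => (1 : Matrix (Fin (l d)) (Fin (l d)) ℝ) i j := by
      filter_upwards [hnhds] with t ht
      rw [← hAeq t ht, hUA]
    exact h1.unique ((hasDerivAt_const _ _).congr_of_eventuallyEq h2)
  have hWA' : ∀ d, W d * ((W d)ᵀ * A' d) = A' d := by
    intro d
    have h1 := congrArg (fun Q => Q * A' d) (hW d).mul_transpose_add
    simpa only [Matrix.add_mul, Matrix.mul_assoc, hUA', Matrix.mul_zero, zero_add,
      Matrix.one_mul] using h1
  -- The core velocity is that of `c` on the shortened interval, and `Z_d` holds the coordinates of
  -- `A'_d` in the frame `W_d`.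
  refine ⟨multilinearMul (fun d => (U d)ᵀ) v,
    ⟨δ, c, hδ, L.contDiff.comp_contDiffOn (hγ.mono hsub), hcM, hc0, hcd⟩,
    fun d => (W d)ᵀ * A' d, ?_⟩
  have hprod := hasDerivAt_multilinearMul hA' hcd
  rw [hA0, hc0] at hprod
  simp only [hWA']
  refine hγd.unique (hprod.congr_of_eventuallyEq ?_)
  filter_upwards [hnhds] with t ht
  rw [← hAeq t ht]
  exact hγA t ht

end Tangent

end StructuredTucker

end

theorem mainTheorem6 {D : ℕ} (n l : Fin D → ℕ) (M : Set (StructuredTucker.Tensor l))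
    (hM : StructuredTucker.IsTuckerCoreStructure M)
    (X : StructuredTucker.Tensor n) (hX : X ∈ StructuredTucker.tuckerManifold M n)
    (U : (d : Fin D) → Matrix (Fin (n d)) (Fin (l d)) ℝ) (C : StructuredTucker.Tensor l)
    (hHOSVD : StructuredTucker.IsHOSVD X U C)
    (Uperp : (d : Fin D) → Matrix (Fin (n d)) (Fin (n d - l d)) ℝ)
    (hUperp : ∀ d, StructuredTucker.IsOrthonormalCompletion (U d) (Uperp d))
    {ι : Type*} (B : ι → StructuredTucker.Tensor l)
    (hB : StructuredTucker.IsOrthonormalBasisOf B (StructuredTucker.tangentSpaceAt M C)) :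
    StructuredTucker.IsOrthonormalBasisOf (StructuredTucker.tangentBasis U Uperp C B)
      (StructuredTucker.tangentSpaceAt (StructuredTucker.tuckerManifold M n) X) := by
  refine ⟨StructuredTucker.orthonormal_tangentBasis hHOSVD hUperp hB.1, Set.ext fun v => ?_⟩
  rw [SetLike.mem_coe, StructuredTucker.mem_span_tangentBasis_iff
    fun d j => (hHOSVD.rowNorm_pos d j).ne']
  -- Replacing the span of `B` by the velocities of `M` at `C` leaves exactly the two curve
  -- inclusions.
  simp only [← SetLike.mem_coe (p := Submodule.span ℝ (Set.range B)), hB.2]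
  constructor
  · rintro ⟨x, hx, Z, rfl⟩
    rw [hHOSVD.eq_mul]
    exact StructuredTucker.multilinearMul_add_sum_mem_tangentSpaceAt hHOSVD.orthonormal
      (fun d => (hUperp d).transpose_mul_self.1) hx Z
  · exact StructuredTucker.exists_of_mem_tangentSpaceAt_tuckerManifold hM hHOSVD hUperp
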